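/- **Setting.** Let $\mathcal X=\mathcal X^{\mathrm{cat}}\times\mathcal X^{\mathrm{int}}\times\mathcal X^{\mathrm{con}}$ with $\mathcal X^{\mathrm{cat}}$ finite, $\mathcal X^{\mathrm{int}}\subseteq\mathbb Z^{p}$, $\mathcal X^{\mathrm{con}}\subseteq\mathbb R^{n}$. Let $f$ and $g_j$ ($j\in J$, $J$ finite) be functions $\mathcal X\to\mathbb R\cup\{+\infty\}$, $\Omega=\{x\in\mathcal X: g_j(x)\le 0\ \forall j\in J\}$, and $h(x)=\sum_{j\in J}\max\{0,g_j(x)\}^2$ for $x\in\mathcal X$, $h=+\infty$ elsewhere. For $x,y\in\Omega$, $x\prec_f y$ means $f(x)<f(y)$; for $x,y\in\mathcal X\setminus\Omega$, $x\prec_h y$ means $f(x)\le f(y)$ and $h(x)\le h(y)$ with at least one strict inequality. **CatMADS with the progressive barrier.** Start from a finite nonempty set $\mathbb X_{(0)}\subseteq\mathcal X$ of known points and the barrier $h^{\max}_{(0)}=+\infty$. At iteration $k$ the incumbents (poll centers), when they exist, are a feasible one $x_{\mathrm{fea}}\in\operatorname{argmin}\{f(x):x\in\Omega\cap\mathbb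 X_{(k)}\}$ and an infeasible one $x_{\mathrm{inf}}\in\operatorname{argmin}\{f(x):x\in\mathbb X_{(k)},\ 0<h(x)\le h^{\max}_{(k)}\}$. Mesh sizes $\delta_{(k)}=(\delta^{\mathrm{int}}_{(k)},\delta^{\mathrm{con}}_{(k)})$ and frame sizes $\Delta_{(k)}\ge\delta_{(k)}>0$ are given variable by variable: $\delta^{\mathrm{int}}_{(k),i}$ is a positive integer; $\Delta_{(k),i}\in\{a10^b: a\in\{1,2,5\}\}$ with $b\in\mathbb N$ for integer variables and $b\in\mathbb Z$ for continuous ones; and $\delta^{\mathrm{con}}_{(k),j}=\rho_j(\Delta^{\mathrm{con}}_{(k),j})$ for a positive nondecreasing function $\rho_j$ with $\rho_j(r)\le r$ and $\rho_j(r)/r\to0$ as $r\searrow0$. The candidates at iteration $k$ are: * finitely many (possibly no) search points, lying in $\mathcal X$ and on the meshes $\mathcal X^{\mathrm{cat}}\times\{x^{\mathrm{qnt}}+\operatorname{diag}(\delta_{(k)})z:z\in\mathbb Z^{p+n}\}$, $x\in\{x_{\mathrm{fea}},x_{\mathrm{inf}}\}$, where $x^{\mathrm{qnt}}=(x^{\mathrm{int}},x^{\mathrm{con}})$;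 * for each incumbent $x$, the quantitative poll $\{(x^{\mathrm{cat}},x^{\mathrm{qnt}}+\operatorname{diag}(\delta_{(k)})d)\in\mathcal X: d\in\mathcal D_{(k)}\}$, where $\mathcal D_{(k)}\subset\mathbb Z^{p+n}$ (one set per incumbent) is finite, positively spans $\mathbb R^{p+n}$ and satisfies $-\Delta_{(k)}\le\operatorname{diag}(\delta_{(k)})d\le\Delta_{(k)}$; * for each incumbent $x$, the categorical poll $(\mathcal N\setminus\{x^{\mathrm{cat}}\})\times\{x^{\mathrm{qnt}}\}$, where $\mathcal N=\mathcal N(x^{\mathrm{cat}};m_{(k)})$ contains $x^{\mathrm{cat}}$ and consists of $m_{(k)}+1$ categorical components closest to $x^{\mathrm{cat}}$ for a categorical distance (nonnegative, zero on the diagonal) ($m_{(k)}$ may differ for the two incumbents); * optionally, when search and poll produce no dominating point, extended polls: from categorical poll points $y$ that are feasible and satisfy $0\le f(y)-f(x_{\mathrm{fea}})\le\xi|f(x_{\mathrm{fea}})|$, or satisfy $0<h(y)\le h^{\max}_{(k)}$ and the same inequalities with $x_{\mathrm{inf}}$, for a parameter $\xi\in\mathbb R\cup\{+\infty\}$ (no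 upper bound if $\xi=+\infty$), finite sequences of quantitative polls (same $\delta_{(k)}$, arbitrary finite direction sets in $\mathbb Z^{p+n}$) are performed, each one centered at a point of the previous poll dominating its center, until a poll yields no point dominating its center or a dominating point in the sense below is found. The iteration is *dominating* if some evaluated candidate $y$ satisfies $y\prec_f x_{\mathrm{fea}}$ or $y\prec_h x_{\mathrm{inf}}$ (the first feasible, respectively infeasible, point found also counts when the corresponding incumbent does not exist); *improving* if it is not dominating and some evaluated $y$ has $0<h(y)<h(x_{\mathrm{inf}})$; *unsuccessful* otherwise. Only dominating iterations may stop before all candidates are evaluated. Evaluated candidates are added to the known points. After a dominating iteration $h^{\max}_{(k+1)}=h(x_{\mathrm{inf}})$ (unchanged if there is no $x_{\mathrm{inf}}$) and the integer mesh sizes and all frame sizes do not decrease. After an improving one $h^{\max}_{(k+1)}=\max\{h(v):v\in\mathbb X_{(k+1)},\,h(v)<h(x_{\mathrm{inf}})\}$ and mesh and frame sizes are unchanged. After an unsuccessful one $h^{\max}$ is kept or set to $h(x_{\mathrm{inf}})$, the frame sizes strictly decrease (integer ones unless already $1$) and the integer mesh sizes do not increase. Consider an infinite execution. **Refining subsequences.**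 Let $K$ be an infinite set of indices of unsuccessful iterations, and for $k\in K$ let $x_{(k)}$ be one of the two poll centers of iteration $k$, with its own $\mathcal D_{(k)}$, $m_{(k)}$ and neighborhood. $\{x_{(k)}\}_{k\in K}$ is a *refining subsequence* with *refined point* $x_\star\in\mathcal X$ if, along $K$, $x_{(k)}\to x_\star$ (categorical and integer components being eventually constant), $\|\delta_{(k)}\|_2^2\to p$, and $m_{(k)}$ and $\mathcal N(x_{(k)}^{\mathrm{cat}};m_{(k)})$ are eventually equal to some $m_\star$ and $\mathcal N(x_\star^{\mathrm{cat}};m_\star)$. A vector $v_\star\in\mathbb R^n\setminus\{0\}$ is a *refining direction* if there are an infinite $L\subseteq K$ and $d_{(k)}=(0,d^{\mathrm{con}}_{(k)})\in\mathcal D_{(k)}$, $k\in L$, such that $v_{(k)}=\operatorname{diag}(\delta^{\mathrm{con}}_{(k)})d^{\mathrm{con}}_{(k)}$ satisfies $v_{(k)}/\|v_{(k)}\|\to v_\star/\|v_\star\|$ along $L$. **Nonsmooth calculus.** Let $f_\star(u)=f(x_\star^{\mathrm{cat}},x_\star^{\mathrm{int}},u)$, $h_\star(u)=h(x_\star^{\mathrm{cat}},x_\star^{\mathrm{int}},u)$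 for $u\in\mathcal X^{\mathrm{con}}$, and $\Lambda_\star=\{u\in\mathcal X^{\mathrm{con}}:(x_\star^{\mathrm{cat}},x_\star^{\mathrm{int}},u)\in\Omega\}$. A function on $\mathcal X^{\mathrm{con}}$ is *Lipschitz near* $x_\star^{\mathrm{con}}$ if it is finite and Lipschitz on $B(x_\star^{\mathrm{con}};\epsilon)\cap\mathcal X^{\mathrm{con}}$ for some $\epsilon>0$. For $S\subseteq\mathbb R^n$, the hypertangent cone $T^H_S$ at $x_\star^{\mathrm{con}}$ is the set of all $v$ for which there is $\epsilon>0$ with $w+tu\in S$ for all $w\in B(x_\star^{\mathrm{con}};\epsilon)\cap S$, $u\in B(v;\epsilon)$, $t\in(0,\epsilon)$. The generalized directional derivative relative to $S$ is $$F^\circ(x_\star^{\mathrm{con}};v)=\limsup_{\substack{w\to x_\star^{\mathrm{con}},\ t\searrow0\\ w\in S,\ w+tv\in S}}\frac{F(w+tv)-F(w)}{t},$$ with $S=\Lambda_\star$ for $F=f_\star$ and $S=\mathcal X^{\mathrm{con}}$ for $F=h_\star$. **Theorem (Convergence of CatMADS).** Let $\{x_{(k)}\}_{k\in K}$ be a refining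 subsequence with refined point $x_\star$ produced by CatMADS with the progressive barrier, and suppose that the set of refining directions of unit norm is dense in the unit sphere of $\mathbb R^n$. (i) If the poll centers $x_{(k)}$, $k\in K$, are feasible, $x_\star\in\Omega$ and $f_\star$ is Lipschitz near $x_\star^{\mathrm{con}}$, then $f_\star^\circ(x_\star^{\mathrm{con}};v)\ge0$ for all $v\in T^H_{\Lambda_\star}$. (ii) If $x_\star\in\mathcal X\setminus\Omega$ and $h_\star$ is Lipschitz near $x_\star^{\mathrm{con}}$, then $h_\star^\circ(x_\star^{\mathrm{con}};v)\ge0$ for all $v\in T^H_{\mathcal X^{\mathrm{con}}}$. -/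

import Mathlib

open Filter Topology

/-! ## Mixed-variable problems -/

/-- A mixed-variable point: a categorical component in the finite set `C` of all categorical
combinations, an integer component with `p` variables and a continuous component with `n`
variables. -/
@[ext]
structure MixedPoint (C : Type*) (p n : ℕ) where
  cat : C
  int : Fin p → ℤ
  cont : EuclideanSpace ℝ (Fin n)

/-- An inequality constrained mixed-variable blackbox problem. The functions take values in
`ℝ ∪ {+∞}`; only their values on the domain `dom` matter. -/
structure MixedProblem (C J : Type*) (p n : ℕ) where
  /-- the integer set -/
  Xint : Set (Fin p → ℤ)
  /-- the continuous set -/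
  Xcont : Set (EuclideanSpace ℝ (Fin n))
  /-- the objective function -/
  f : MixedPoint C p n → EReal
  /-- the constraint functions -/
  g : J → MixedPoint C p n → EReal
  f_ne_bot : ∀ x, f x ≠ ⊥
  g_ne_bot : ∀ j x, g j x ≠ ⊥

/-- The two kinds of poll centers of the progressive barrier: feasible and infeasible. -/
inductive CenterKind
  | fea
  | inf

namespace MixedProblem

variable {C J : Type*} {p n : ℕ}

/-- The domain: all categories, times the integer set, times the continuous set. -/
def dom (P : MixedProblem C J p n) : Set (MixedPoint C p n) :=
  {x | x.int ∈ P.Xint ∧ x.cont ∈ P.Xcont}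

/-- The feasible set `Ω`. -/
def feasible (P : MixedProblem C J p n) : Set (MixedPoint C p n) :=
  {x | x ∈ P.dom ∧ ∀ j, P.g j x ≤ 0}

open Classical in
/-- The constraint violation function `h`. -/
noncomputable def h [Fintype J] (P : MixedProblem C J p n) (x : MixedPoint C p n) : EReal :=
  if x ∈ P.dom then ∑ j, (max 0 (P.g j x)) ^ 2 else ⊤

/-- The set in which the incumbents of the given kind lie: `Ω`, or its complement in the
domain. -/
def region (P : MixedProblem C J p n) : CenterKind → Set (MixedPoint C p n)
  | .fea => P.feasible
  | .inf => P.dom \ P.feasible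

/-- `P.Dominates s x y` means that `x` dominates `y`, in the sense of feasible dominance when
`s = fea` and of infeasible dominance when `s = inf`. -/
def Dominates [Fintype J] (P : MixedProblem C J p n) :
    CenterKind → MixedPoint C p n → MixedPoint C p n → Prop
  | .fea, x, y => x ∈ P.feasible ∧ y ∈ P.feasible ∧ P.f x < P.f y
  | .inf, x, y => x ∈ P.dom \ P.feasible ∧ y ∈ P.dom \ P.feasible ∧
      P.f x ≤ P.f y ∧ P.h x ≤ P.h y ∧ (P.f x < P.f y ∨ P.h x < P.h y)

/-- The points of `A` that can be the feasible, respectively infeasible, incumbent when the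
barrier is `b`. -/
def eligible [Fintype J] (P : MixedProblem C J p n) (A : Set (MixedPoint C p n)) (b : EReal) :
    CenterKind → Set (MixedPoint C p n)
  | .fea => {x | x ∈ A ∧ x ∈ P.feasible}
  | .inf => {x | x ∈ A ∧ 0 < P.h x ∧ P.h x ≤ b}

/-- The restriction `f_⋆` of the objective to the continuous variables, the categorical and
integer components being those of `x`. -/
def fStar (P : MixedProblem C J p n) (x : MixedPoint C p n) (u : EuclideanSpace ℝ (Fin n)) :
    EReal :=
  P.f ⟨x.cat, x.int, u⟩

/-- The restriction `h_⋆` of the constraint violation to the continuous variables. -/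
noncomputable def hStar [Fintype J] (P : MixedProblem C J p n) (x : MixedPoint C p n)
    (u : EuclideanSpace ℝ (Fin n)) : EReal :=
  P.h ⟨x.cat, x.int, u⟩

/-- The continuous feasible set `Λ_⋆` at `x`. -/
def contFeasible (P : MixedProblem C J p n) (x : MixedPoint C p n) :
    Set (EuclideanSpace ℝ (Fin n)) :=
  {u | u ∈ P.Xcont ∧ (⟨x.cat, x.int, u⟩ : MixedPoint C p n) ∈ P.feasible}

end MixedProblem

/-! ## Nonsmooth calculus in the continuous variables -/

/-- `F` is (finite and) Lipschitz near `u`, as a function on `S`. -/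
def LipschitzNear {n : ℕ} (S : Set (EuclideanSpace ℝ (Fin n)))
    (F : EuclideanSpace ℝ (Fin n) → EReal) (u : EuclideanSpace ℝ (Fin n)) : Prop :=
  ∃ ε > 0, ∃ L : ℝ,
    (∀ w ∈ Metric.ball u ε ∩ S, F w ≠ ⊥ ∧ F w ≠ ⊤) ∧
    ∀ w ∈ Metric.ball u ε ∩ S, ∀ w' ∈ Metric.ball u ε ∩ S,
      |(F w).toReal - (F w').toReal| ≤ L * ‖w - w'‖

/-- The hypertangent cone to `S` at `u`. -/
def hypertangentCone {n : ℕ} (S : Set (EuclideanSpace ℝ (Fin n)))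
    (u : EuclideanSpace ℝ (Fin n)) : Set (EuclideanSpace ℝ (Fin n)) :=
  {v | ∃ ε > 0, ∀ w ∈ Metric.ball u ε ∩ S, ∀ v' ∈ Metric.ball v ε, ∀ t ∈ Set.Ioo (0 : ℝ) ε,
    w + t • v' ∈ S}

/-- The generalized directional derivative `F°(u; v)` relative to `S`: the upper limit, in the
extended reals, of `(F (w + t v) - F w) / t` as `w → u` and `t ↘ 0` with `w ∈ S` and
`w + t v ∈ S`. -/
noncomputable def clarkeDeriv {n : ℕ} (S : Set (EuclideanSpace ℝ (Fin n)))
    (F : EuclideanSpace ℝ (Fin n) → EReal) (u v : EuclideanSpace ℝ (Fin n)) : EReal :=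
  limsup (fun q : EuclideanSpace ℝ (Fin n) × ℝ => (F (q.1 + q.2 • v) - F q.1) / (q.2 : EReal))
    ((𝓝 u ×ˢ 𝓝[>] (0 : ℝ)) ⊓ 𝓟 {q | q.1 ∈ S ∧ q.1 + q.2 • v ∈ S})

/-! ## Meshes and polls -/

/-- Poll directions: an integer vector for the integer variables and one for the continuous
variables (before scaling by the mesh size). -/
abbrev Direction (p n : ℕ) : Type := (Fin p → ℤ) × (Fin n → ℤ)

/-- `diag(δ) d` for the continuous variables. -/
noncomputable def scaledDir {n : ℕ} (δ : Fin n → ℝ) (d : Fin n → ℤ) :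
    EuclideanSpace ℝ (Fin n) :=
  WithLp.toLp 2 fun j => δ j * (d j : ℝ)

/-- `x^qnt + diag(δ) d`, with the given category. -/
noncomputable def meshPoint {C : Type*} {p n : ℕ} (δint : Fin p → ℕ) (δcont : Fin n → ℝ)
    (c : C) (x : MixedPoint C p n) (d : Direction p n) : MixedPoint C p n :=
  ⟨c, fun i => x.int i + (δint i : ℤ) * d.1 i, x.cont + scaledDir δcont d.2⟩

/-- `D` positively spans the quantitative space `ℝ^p × ℝ^n`. -/
def PositivelySpans {p n : ℕ} (D : Finset (Direction p n)) : Prop :=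
  ∀ (a : Fin p → ℝ) (b : Fin n → ℝ), ∃ c : Direction p n → ℝ, (∀ d ∈ D, 0 ≤ c d) ∧
    (∀ i, ∑ d ∈ D, c d * (d.1 i : ℝ) = a i) ∧ (∀ j, ∑ d ∈ D, c d * (d.2 j : ℝ) = b j)

/-- `N` is a distance-induced neighborhood of `c`: `m + 1` categorical components closest to `c`,
one of which is `c` itself (ties may be broken in any way). -/
def IsDistanceNeighborhood {C : Type*} (dist : C → C → ℝ) (c : C) (m : ℕ) (N : Finset C) : Prop :=
  N.card = m + 1 ∧ c ∈ N ∧ ∀ u ∈ N, ∀ v ∉ N, dist c u ≤ dist c v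

/-- The frame sizes allowed for an integer variable. -/
def intFrameSizes : Set ℕ := {r | ∃ a ∈ ({1, 2, 5} : Set ℕ), ∃ b : ℕ, r = a * 10 ^ b}

/-- The frame sizes allowed for a continuous variable. -/
def contFrameSizes : Set ℝ := {r | ∃ a ∈ ({1, 2, 5} : Set ℝ), ∃ b : ℤ, r = a * (10 : ℝ) ^ b}

/-- A rule giving the mesh size of a continuous variable from its frame size: it is positive,
nondecreasing, at most the frame size, and goes to zero more rapidly than the frame size.
Examples are `min Δ (Δ ^ 2)` and, for a frame size `a * 10 ^ b`, the granular rule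
`10 ^ (b - |b - b₀|)`. -/
structure IsMeshSizeRule (ρ : ℝ → ℝ) : Prop where
  pos : ∀ r, 0 < r → 0 < ρ r
  le_self : ∀ r, 0 < r → ρ r ≤ r
  mono : MonotoneOn ρ (Set.Ioi 0)
  fast : Tendsto (fun r => ρ r / r) (𝓝[>] 0) (𝓝 0)

namespace MixedProblem

variable {C J : Type*} {p n : ℕ}

/-- The mesh centered at `x`, inside the domain. -/
def mesh (P : MixedProblem C J p n) (δint : Fin p → ℕ) (δcont : Fin n → ℝ)
    (x : MixedPoint C p n) : Set (MixedPoint C p n) :=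
  {y | y ∈ P.dom ∧ ∃ (c : C) (z : Direction p n), y = meshPoint δint δcont c x z}

/-- The quantitative poll at `x` with directions `D`. -/
def quantPoll (P : MixedProblem C J p n) (δint : Fin p → ℕ) (δcont : Fin n → ℝ)
    (x : MixedPoint C p n) (D : Finset (Direction p n)) : Set (MixedPoint C p n) :=
  {y | y ∈ P.dom ∧ ∃ d ∈ D, y = meshPoint δint δcont x.cat x d}

/-- The `ξ`-extended poll trigger at `y` for the incumbent `x`:
`0 ≤ f y - f x ≤ ξ |f x|`, always satisfied from above when `ξ = ∞`. -/
def ExtendedPollTrigger (P : MixedProblem C J p n) (ξ : EReal) (x y : MixedPoint C p n) : Prop :=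
  P.f x ≤ P.f y ∧ (ξ = ⊤ ∨ P.f y ≤ P.f x + ξ * ((P.f x).abs : EReal))

end MixedProblem

/-- The categorical poll at `x` with neighborhood `N` of its category. -/
def catPoll {C : Type*} {p n : ℕ} (x : MixedPoint C p n) (N : Finset C) :
    Set (MixedPoint C p n) :=
  {y | y.cat ∈ N ∧ y.cat ≠ x.cat ∧ y.int = x.int ∧ y.cont = x.cont}

/-! ## Instances of CatMADS with the progressive barrier -/

/-- The data recorded along an execution of CatMADS with the progressive barrier, iteration by
iteration (the stopping criteria being disregarded). -/
structure CatMADSData (C : Type*) (p n : ℕ) where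
  /-- set `𝕏` of known points at the beginning of the iteration -/
  known : ℕ → Set (MixedPoint C p n)
  /-- feasible and infeasible incumbents at the beginning of the iteration, when they exist -/
  center : CenterKind → ℕ → Option (MixedPoint C p n)
  /-- barrier parameter `h^max` -/
  hmax : ℕ → EReal
  /-- integer and continuous mesh sizes `δ` -/
  δint : ℕ → Fin p → ℕ
  δcont : ℕ → Fin n → ℝ
  /-- integer and continuous frame sizes `Δ` -/
  Δint : ℕ → Fin p → ℕ
  Δcont : ℕ → Fin n → ℝ
  /-- search points -/
  search : ℕ → Set (MixedPoint C p n)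
  /-- directions of the feasible and infeasible quantitative polls -/
  dirs : CenterKind → ℕ → Finset (Direction p n)
  /-- categorical distance -/
  dcat : ℕ → C → C → ℝ
  /-- numbers of neighbors of the feasible and infeasible categorical polls -/
  m : CenterKind → ℕ → ℕ
  /-- distance-induced neighborhoods of the feasible and infeasible categorical polls -/
  nbhd : CenterKind → ℕ → Finset C
  /-- parameter of the extended poll trigger -/
  ξ : EReal
  /-- selected points at which extended polls are initiated -/
  extStart : ℕ → Set (MixedPoint C p n)
  /-- `extLen k y` is the index `s` of the endpoint of the extended poll initiated at `y` -/
  extLen : ℕ → MixedPoint C p n → ℕ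
  /-- `extPt k y i` is the iterate `y_(i)` of the extended poll initiated at `y` -/
  extPt : ℕ → MixedPoint C p n → ℕ → MixedPoint C p n
  /-- directions of the quantitative poll at `y_(i)` -/
  extDirs : ℕ → MixedPoint C p n → ℕ → Finset (Direction p n)
  /-- points whose functions are evaluated during the iteration -/
  evaluated : ℕ → Set (MixedPoint C p n)

namespace CatMADSData

variable {C J : Type*} [Fintype J] {p n : ℕ}

/-- The poll set `P_(k)`: categorical and quantitative polls at both incumbents. -/
def poll (R : CatMADSData C p n) (P : MixedProblem C J p n) (k : ℕ) : Set (MixedPoint C p n) :=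
  {y | ∃ s, ∃ x ∈ R.center s k,
    y ∈ catPoll x (R.nbhd s k) ∪ P.quantPoll (R.δint k) (R.δcont k) x (R.dirs s k)}

/-- The union of the categorical polls at both incumbents. -/
def catPolls (R : CatMADSData C p n) (k : ℕ) : Set (MixedPoint C p n) :=
  {y | ∃ s, ∃ x ∈ R.center s k, y ∈ catPoll x (R.nbhd s k)}

/-- The points of the categorical polls selected by the extended poll trigger. -/
def selected (R : CatMADSData C p n) (P : MixedProblem C J p n) (k : ℕ) :
    Set (MixedPoint C p n) :=
  {y | y ∈ R.catPolls k ∧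
    ((P.h y = 0 ∧ ∃ x ∈ R.center .fea k, P.ExtendedPollTrigger R.ξ x y) ∨
      (0 < P.h y ∧ P.h y ≤ R.hmax k ∧ ∃ x ∈ R.center .inf k, P.ExtendedPollTrigger R.ξ x y))}

/-- The extended poll `\bar P_(k)`: all quantitative polls around the iterates of the extended
polls. -/
def extPoll (R : CatMADSData C p n) (P : MixedProblem C J p n) (k : ℕ) :
    Set (MixedPoint C p n) :=
  {w | ∃ y ∈ R.extStart k, ∃ i ≤ R.extLen k y,
    w ∈ P.quantPoll (R.δint k) (R.δcont k) (R.extPt k y i) (R.extDirs k y i)}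

/-- `y` dominates the incumbent of its own kind (any point does, when there is none). -/
def IsDominatingPoint (R : CatMADSData C p n) (P : MixedProblem C J p n) (k : ℕ)
    (y : MixedPoint C p n) : Prop :=
  ∃ s, y ∈ P.region s ∧ ∀ x ∈ R.center s k, P.Dominates s y x

/-- Iteration `k` is dominating. -/
def IsDominating (R : CatMADSData C p n) (P : MixedProblem C J p n) (k : ℕ) : Prop :=
  ∃ y ∈ R.evaluated k, R.IsDominatingPoint P k y

/-- Iteration `k` is improving. -/
def IsImproving (R : CatMADSData C p n) (P : MixedProblem C J p n) (k : ℕ) : Prop :=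
  ¬ R.IsDominating P k ∧
    ∃ y ∈ R.evaluated k, ∃ x ∈ R.center .inf k, 0 < P.h y ∧ P.h y < P.h x

/-- Iteration `k` is unsuccessful. -/
def IsUnsuccessful (R : CatMADSData C p n) (P : MixedProblem C J p n) (k : ℕ) : Prop :=
  ¬ R.IsDominating P k ∧ ¬ R.IsImproving P k

end CatMADSData

/-- `R` is the record of an execution of CatMADS with the progressive barrier on the problem
`P`. -/
structure IsCatMADSRun {C J : Type*} [Fintype J] {p n : ℕ} (P : MixedProblem C J p n)
    (R : CatMADSData C p n) : Prop where
  -- initialization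
  known_zero_nonempty : (R.known 0).Nonempty
  known_zero_finite : (R.known 0).Finite
  known_zero_subset : R.known 0 ⊆ P.dom
  hmax_zero : R.hmax 0 = ⊤
  ξ_ne_bot : R.ξ ≠ ⊥
  -- incumbents: minimizers of `f` among the eligible known points, whenever there are such points
  center_mem : ∀ s k, ∀ x ∈ R.center s k, x ∈ P.eligible (R.known k) (R.hmax k) s ∧
    ∀ y ∈ P.eligible (R.known k) (R.hmax k) s, P.f x ≤ P.f y
  center_none : ∀ s k, R.center s k = none → P.eligible (R.known k) (R.hmax k) s = ∅
  -- mesh and frame sizes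
  δint_pos : ∀ k i, 1 ≤ R.δint k i
  δint_le : ∀ k i, R.δint k i ≤ R.Δint k i
  Δint_mem : ∀ k i, R.Δint k i ∈ intFrameSizes
  Δcont_mem : ∀ k j, R.Δcont k j ∈ contFrameSizes
  δcont_rule : ∀ j, ∃ ρ : ℝ → ℝ, IsMeshSizeRule ρ ∧ ∀ k, R.δcont k j = ρ (R.Δcont k j)
  -- search: finitely many mesh points, possibly none
  search_finite : ∀ k, (R.search k).Finite
  search_mesh : ∀ k, ∀ y ∈ R.search k, ∃ s, ∃ x ∈ R.center s k,
    y ∈ P.mesh (R.δint k) (R.δcont k) x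
  -- quantitative polls: positive spanning sets of directions within the frame
  dirs_span : ∀ s k, (R.center s k).isSome → PositivelySpans (R.dirs s k)
  dirs_frame : ∀ s k, (R.center s k).isSome → ∀ d ∈ R.dirs s k,
    (∀ i, |(R.δint k i : ℤ) * d.1 i| ≤ (R.Δint k i : ℤ)) ∧
    (∀ j, |R.δcont k j * (d.2 j : ℝ)| ≤ R.Δcont k j)
  -- categorical polls
  dcat_nonneg : ∀ k c c', 0 ≤ R.dcat k c c'
  dcat_self : ∀ k c, R.dcat k c c = 0
  nbhd_spec : ∀ s k, ∀ x ∈ R.center s k,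
    IsDistanceNeighborhood (R.dcat k) x.cat (R.m s k) (R.nbhd s k)
  -- extended polls: optional, only if the search and the poll found no dominating point
  ext_selected : ∀ k, R.extStart k ⊆ R.selected P k
  ext_after_poll : ∀ k, (R.extStart k).Nonempty → R.search k ∪ R.poll P k ⊆ R.evaluated k ∧
    ∀ y ∈ R.search k ∪ R.poll P k, ¬ R.IsDominatingPoint P k y
  ext_start : ∀ k, ∀ y ∈ R.extStart k, R.extPt k y 0 = y
  ext_step : ∀ k, ∀ y ∈ R.extStart k, ∀ i < R.extLen k y,
    R.extPt k y (i + 1) ∈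
      P.quantPoll (R.δint k) (R.δcont k) (R.extPt k y i) (R.extDirs k y i) ∧
    ∀ s, y ∈ P.region s → P.Dominates s (R.extPt k y (i + 1)) (R.extPt k y i)
  ext_end : ∀ k, ¬ R.IsDominating P k → ∀ y ∈ R.extStart k,
    ∀ w ∈ P.quantPoll (R.δint k) (R.δcont k) (R.extPt k y (R.extLen k y))
      (R.extDirs k y (R.extLen k y)),
    ∀ s, y ∈ P.region s → ¬ P.Dominates s w (R.extPt k y (R.extLen k y))
  -- evaluations: all candidates, except that dominating iterations may be stopped early
  evaluated_subset : ∀ k, R.evaluated k ⊆ R.search k ∪ R.poll P k ∪ R.extPoll P k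
  evaluated_all : ∀ k, ¬ R.IsDominating P k →
    R.search k ∪ R.poll P k ∪ R.extPoll P k ⊆ R.evaluated k
  known_succ : ∀ k, R.known (k + 1) = R.known k ∪ R.evaluated k
  -- update after a dominating iteration
  hmax_dominating : ∀ k, R.IsDominating P k →
    (R.center .inf k = none → R.hmax (k + 1) = R.hmax k) ∧
    ∀ x ∈ R.center .inf k, R.hmax (k + 1) = P.h x
  mesh_dominating : ∀ k, R.IsDominating P k →
    R.δint k ≤ R.δint (k + 1) ∧ R.Δint k ≤ R.Δint (k + 1) ∧ R.Δcont k ≤ R.Δcont (k + 1)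
  -- update after an improving iteration
  hmax_improving : ∀ k, R.IsImproving P k → ∀ x ∈ R.center .inf k,
    IsGreatest {r | r < P.h x ∧ ∃ v ∈ R.known (k + 1), P.h v = r} (R.hmax (k + 1))
  mesh_improving : ∀ k, R.IsImproving P k →
    R.δint (k + 1) = R.δint k ∧ R.Δint (k + 1) = R.Δint k ∧ R.Δcont (k + 1) = R.Δcont k
  -- update after an unsuccessful iteration: the barrier is kept, or lowered to the value of the
  -- infeasible incumbent
  hmax_unsuccessful : ∀ k, R.IsUnsuccessful P k →
    R.hmax (k + 1) = R.hmax k ∨ ∃ x ∈ R.center .inf k, R.hmax (k + 1) = P.h x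
  mesh_unsuccessful : ∀ k, R.IsUnsuccessful P k →
    (∀ i, R.δint (k + 1) i ≤ R.δint k i) ∧
    (∀ i, R.Δint (k + 1) i < R.Δint k i ∨ (R.Δint k i = 1 ∧ R.Δint (k + 1) i = 1)) ∧
    (∀ j, R.Δcont (k + 1) j < R.Δcont k j)

/-! ## Refining subsequences -/

/-- `(x k)` for `k ∈ K` is a refining subsequence of the execution `R`, with refined point `xs`.
For `k ∈ K`, the iteration is unsuccessful and `x k` is the poll center of kind `s k`. Limits of
categorical components, of integer components, of numbers of neighbors and of neighborhoods are
taken in discrete spaces, i.e. they mean that these objects are eventually equal to their limit. -/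
structure IsRefiningSubsequence {C J : Type*} [Fintype J] {p n : ℕ} (P : MixedProblem C J p n)
    (R : CatMADSData C p n) (K : Set ℕ) (s : ℕ → CenterKind) (x : ℕ → MixedPoint C p n)
    (xs : MixedPoint C p n) : Prop where
  infinite : K.Infinite
  unsuccessful : ∀ k ∈ K, R.IsUnsuccessful P k
  pollCenter : ∀ k ∈ K, R.center (s k) k = some (x k)
  mem_dom : xs ∈ P.dom
  cat_lim : ∀ᶠ k in atTop ⊓ 𝓟 K, (x k).cat = xs.cat
  int_lim : ∀ᶠ k in atTop ⊓ 𝓟 K, (x k).int = xs.int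
  cont_lim : Tendsto (fun k => (x k).cont) (atTop ⊓ 𝓟 K) (𝓝 xs.cont)
  mesh_lim : Tendsto (fun k => ∑ i, (R.δint k i : ℝ) ^ 2 + ∑ j, (R.δcont k j) ^ 2)
    (atTop ⊓ 𝓟 K) (𝓝 (p : ℝ))
  nbhd_lim : ∃ (ms : ℕ) (Ns : Finset C), ∀ᶠ k in atTop ⊓ 𝓟 K,
    R.m (s k) k = ms ∧ R.nbhd (s k) k = Ns ∧ IsDistanceNeighborhood (R.dcat k) xs.cat ms Ns

/-- `v` is a refining direction: for an infinite `L ⊆ K` and poll directions `d k` (`k ∈ L`) with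
zero integer part, the normalized scaled continuous parts of `d k` converge to `v / ‖v‖`. -/
def IsRefiningDirection {C : Type*} {p n : ℕ} (R : CatMADSData C p n) (K : Set ℕ)
    (s : ℕ → CenterKind) (v : EuclideanSpace ℝ (Fin n)) : Prop :=
  v ≠ 0 ∧ ∃ (L : Set ℕ) (d : ℕ → Direction p n), L ⊆ K ∧ L.Infinite ∧
    (∀ k ∈ L, d k ∈ R.dirs (s k) k ∧ (d k).1 = 0) ∧
    Tendsto (fun k => ‖scaledDir (R.δcont k) (d k).2‖⁻¹ • scaledDir (R.δcont k) (d k).2)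
      (atTop ⊓ 𝓟 L) (𝓝 (‖v‖⁻¹ • v))

/-!
The generalized derivative is bounded below along the quantitative polls themselves. Since
`δint ≥ 1`, the limit `‖δ‖² → p` forces the continuous mesh sizes to zero, and then the monotone
positive mesh size rule forces the continuous frame sizes to zero as well
(`tendsto_Δcont_zero`); hence the scaled poll directions, which lie in the frames, shrink to zero.

Given a hypertangent direction `v ≠ 0` and `η > 0`, density provides a refining direction whose
positive multiple is within `η` of `v`. Writing the corresponding poll points as `w + t d`, with `w`
the poll center, `d` close to `v` and `t ↘ 0` (`exists_refining_poll_steps`), hypertangency puts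
`w + t d` and `w + t v` in the set, and the failure of the iteration gives `F w ≤ F (w + t d)`.
A Lipschitz estimate replaces `d` by `v` at the cost of `L * η`, so that `F° ≥ -L * η` for every
`η` (`clarkeDeriv_nonneg_of_steps`); no continuity of `F°` in the direction is needed.

For the constraint violation, failure of an iteration only says that no evaluated point satisfies
`0 < h y < h x`, and only about the infeasible poll center. By continuity `h` is near
`h xs > 0` both at the centers and at the poll points, so eventually the centers are infeasible ones
and the poll points have positive violation.
-/

/-! ### Generalized directional derivatives along sequences of steps -/

/-- If, for directions `d` arbitrarily close to `v`, steps `w + t d` that stay in `S` do not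
decrease `F` along some sequence with `w → u` and `t ↘ 0`, then the generalized derivative in the
hypertangent direction `v` is nonnegative. -/
theorem clarkeDeriv_nonneg_of_steps {n : ℕ} {S X : Set (EuclideanSpace ℝ (Fin n))}
    {F : EuclideanSpace ℝ (Fin n) → EReal} {u v : EuclideanSpace ℝ (Fin n)} (hSX : S ⊆ X)
    (hF : LipschitzNear X F u) (hv : v ∈ hypertangentCone S u)
    (hsteps : ∀ η > 0, ∃ (l : Filter ℕ) (w d : ℕ → EuclideanSpace ℝ (Fin n)) (t : ℕ → ℝ),
      l.NeBot ∧ Tendsto w l (𝓝 u) ∧ (∀ᶠ k in l, w k ∈ S) ∧ Tendsto t l (𝓝[>] 0) ∧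
      (∀ᶠ k in l, d k ∈ Metric.ball v η) ∧
      ∀ᶠ k in l, w k + t k • d k ∈ S → F (w k) ≤ F (w k + t k • d k)) :
    0 ≤ clarkeDeriv S F u v := by
  obtain ⟨ε₁, hε₁, L, hfin, hL⟩ := hF
  obtain ⟨ε₂, hε₂, hcone⟩ := hv
  have key : ∀ η > 0, ((-(|L| * η) : ℝ) : EReal) ≤ clarkeDeriv S F u v := by
    intro η hη
    obtain ⟨l, w, d, t, hl, hw, hwS, ht, hd, hle⟩ := hsteps (min η ε₂) (lt_min hη hε₂)
    have ht0 : Tendsto t l (𝓝 0) := ht.mono_right nhdsWithin_le_nhds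
    have htpos : ∀ᶠ k in l, 0 < t k := ht.eventually self_mem_nhdsWithin
    have htv : Tendsto (fun k => w k + t k • v) l (𝓝 u) := by
      simpa using hw.add (ht0.smul_const v)
    have htd : Tendsto (fun k => w k + t k • d k) l (𝓝 u) := by
      have h0 : Tendsto (fun k => t k • (d k - v)) l (𝓝 0) := by
        refine ht0.zero_smul_isBoundedUnder_le ⟨min η ε₂, ?_⟩
        rw [eventually_map]
        filter_upwards [hd] with k hk
        rw [Metric.mem_ball, dist_eq_norm] at hk
        exact hk.le
      refine (by simpa using htv.add h0 : Tendsto _ l (𝓝 u)).congr fun k => ?_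
      module
    have hball : Metric.ball u ε₁ ∈ 𝓝 u := Metric.ball_mem_nhds u hε₁
    have hSv : ∀ᶠ k in l, w k + t k • v ∈ S := by
      filter_upwards [hw.eventually (Metric.ball_mem_nhds u hε₂), hwS, htpos,
        ht0.eventually (gt_mem_nhds hε₂)] with k h1 h2 h3 h4
      exact hcone _ ⟨h1, h2⟩ _ (Metric.mem_ball_self hε₂) _ ⟨h3, h4⟩
    have hSd : ∀ᶠ k in l, w k + t k • d k ∈ S := by
      filter_upwards [hw.eventually (Metric.ball_mem_nhds u hε₂), hwS, htpos,
        ht0.eventually (gt_mem_nhds hε₂), hd] with k h1 h2 h3 h4 h5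
      exact hcone _ ⟨h1, h2⟩ _ (Metric.ball_subset_ball (min_le_right _ _) h5) _ ⟨h3, h4⟩
    have hq : Tendsto (fun k => (w k, t k)) l
        ((𝓝 u ×ˢ 𝓝[>] (0 : ℝ)) ⊓ 𝓟 {q | q.1 ∈ S ∧ q.1 + q.2 • v ∈ S}) :=
      tendsto_inf.2 ⟨hw.prodMk ht, tendsto_principal.2 (hwS.and hSv)⟩
    refine le_limsup_of_frequently_le (hq.frequently (Eventually.frequently ?_))
    filter_upwards [hw.eventually hball, hwS, htpos, hd, hSv, hSd, htv.eventually hball,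
      htd.eventually hball, hle] with k h1 h2 h3 h4 h5 h6 h7 h8 h9
    have h9 := h9 h6
    have hLip := hL _ ⟨h7, hSX h5⟩ _ ⟨h8, hSX h6⟩
    obtain ⟨a, ha⟩ : ∃ a : ℝ, F (w k) = a :=
      ⟨_, (EReal.coe_toReal (hfin _ ⟨h1, hSX h2⟩).2 (hfin _ ⟨h1, hSX h2⟩).1).symm⟩
    obtain ⟨b, hb⟩ : ∃ b : ℝ, F (w k + t k • v) = b :=
      ⟨_, (EReal.coe_toReal (hfin _ ⟨h7, hSX h5⟩).2 (hfin _ ⟨h7, hSX h5⟩).1).symm⟩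
    obtain ⟨c, hc⟩ : ∃ c : ℝ, F (w k + t k • d k) = c :=
      ⟨_, (EReal.coe_toReal (hfin _ ⟨h8, hSX h6⟩).2 (hfin _ ⟨h8, hSX h6⟩).1).symm⟩
    rw [ha, hc, EReal.coe_le_coe_iff] at h9
    rw [hb, hc, EReal.toReal_coe, EReal.toReal_coe] at hLip
    have hnorm : ‖w k + t k • v - (w k + t k • d k)‖ ≤ t k * η := by
      have : w k + t k • v - (w k + t k • d k) = t k • (v - d k) := by module
      rw [this, norm_smul, Real.norm_of_nonneg h3.le]
      rw [Metric.mem_ball, dist_comm, dist_eq_norm] at h4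
      exact mul_le_mul_of_nonneg_left (h4.le.trans (min_le_left _ _)) h3.le
    have hbc : |b - c| ≤ |L| * (t k * η) :=
      hLip.trans ((mul_le_mul_of_nonneg_right (le_abs_self L) (norm_nonneg _)).trans
        (mul_le_mul_of_nonneg_left hnorm (abs_nonneg L)))
    change _ ≤ (F (w k + t k • v) - F (w k)) / (t k : EReal)
    rw [ha, hb, ← EReal.coe_sub, ← EReal.coe_div, EReal.coe_le_coe_iff, le_div_iff₀ h3]
    have := (abs_le.1 hbc).1
    linarith
  refine le_of_tendsto (x := 𝓝[>] (0 : ℝ)) (f := fun η : ℝ => ((-(|L| * η) : ℝ) : EReal)) ?_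
    (eventually_mem_nhdsWithin.mono key)
  have : Tendsto (fun η : ℝ => -(|L| * η)) (𝓝[>] 0) (𝓝 0) := by
    have : Continuous fun η : ℝ => -(|L| * η) := by fun_prop
    exact (by simpa using this.tendsto 0 : Tendsto _ (𝓝 (0 : ℝ)) _).mono_left
      nhdsWithin_le_nhds
  exact_mod_cast (continuous_coe_real_ereal.tendsto 0).comp this

theorem LipschitzNear.eventually_pos {n : ℕ} {S : Set (EuclideanSpace ℝ (Fin n))}
    {F : EuclideanSpace ℝ (Fin n) → EReal} {u : EuclideanSpace ℝ (Fin n)}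
    (hF : LipschitzNear S F u) (hu : u ∈ S) (hpos : 0 < F u) : ∀ᶠ w in 𝓝[S] u, 0 < F w := by
  obtain ⟨ε, hε, L, hfin, hL⟩ := hF
  have huB : u ∈ Metric.ball u ε ∩ S := ⟨Metric.mem_ball_self hε, hu⟩
  have hu0 : 0 < (F u).toReal := EReal.toReal_pos hpos (hfin u huB).2
  have hlim : Tendsto (fun w => L * ‖u - w‖) (𝓝[S] u) (𝓝 0) := by
    have : Continuous fun w => L * ‖u - w‖ := by fun_prop
    exact (by simpa using this.tendsto u : Tendsto _ (𝓝 u) _).mono_left nhdsWithin_le_nhds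
  filter_upwards [hlim.eventually (gt_mem_nhds hu0), self_mem_nhdsWithin,
    nhdsWithin_le_nhds (Metric.ball_mem_nhds u hε)] with w h1 h2 h3
  have h4 := (abs_le.1 (hL u huB w ⟨h3, h2⟩)).2
  have h5 : 0 < (F w).toReal := by linarith
  rw [← EReal.coe_toReal (hfin w ⟨h3, h2⟩).2 (hfin w ⟨h3, h2⟩).1]
  exact_mod_cast h5

/-! ### Constraint violation and failure of an iteration -/

namespace MixedProblem

variable {C J : Type*} [Fintype J] {p n : ℕ} {P : MixedProblem C J p n} {x : MixedPoint C p n}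

theorem h_eq_zero_of_mem_feasible (hx : x ∈ P.feasible) : P.h x = 0 := by
  rw [h, if_pos hx.1]
  refine Finset.sum_eq_zero fun j _ => ?_
  rw [max_eq_left (hx.2 j)]
  simp

theorem h_pos_of_notMem_feasible (hx : x ∉ P.feasible) : 0 < P.h x := by
  rw [h]
  split_ifs with hd
  · have hnn : ∀ j ∈ Finset.univ, 0 ≤ (max 0 (P.g j x)) ^ 2 := fun j _ =>
      pow_nonneg (le_max_left _ _) 2
    obtain ⟨j, hj⟩ : ∃ j, 0 < P.g j x := by
      by_contra! hcon
      exact hx ⟨hd, hcon⟩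
    refine lt_of_lt_of_le ?_ (Finset.single_le_sum hnn (Finset.mem_univ j))
    rw [max_eq_right hj.le, pow_two]
    exact EReal.mul_pos hj hj
  · exact EReal.zero_lt_top

theorem notMem_feasible_of_h_pos (hx : 0 < P.h x) : x ∉ P.feasible := fun hf =>
  hx.ne' (h_eq_zero_of_mem_feasible hf)

end MixedProblem

namespace IsCatMADSRun

variable {C J : Type*} [Fintype J] {p n : ℕ} {P : MixedProblem C J p n} {R : CatMADSData C p n}

theorem known_subset_dom (hR : IsCatMADSRun P R) (k : ℕ) : R.known k ⊆ P.dom := by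
  induction k with
  | zero => exact hR.known_zero_subset
  | succ k ih =>
    rw [hR.known_succ]
    refine Set.union_subset ih fun y hy => ?_
    rcases hR.evaluated_subset k hy with (hy | ⟨s, x, hx, hy | hy⟩) | ⟨_, _, _, _, hy⟩
    · obtain ⟨_, _, _, hy⟩ := hR.search_mesh k y hy
      exact hy.1
    · have hxd : x ∈ P.dom := by
        have := (hR.center_mem s k x hx).1
        cases s <;> exact ih this.1
      exact ⟨hy.2.2.1 ▸ hxd.1, hy.2.2.2 ▸ hxd.2⟩
    · exact hy.1
    · exact hy.1

theorem center_mem_dom (hR : IsCatMADSRun P R) {s : CenterKind} {k : ℕ} {x : MixedPoint C p n}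
    (hx : R.center s k = some x) : x ∈ P.dom := by
  have := (hR.center_mem s k x hx).1
  cases s <;> exact hR.known_subset_dom k this.1

theorem kind_eq_fea (hR : IsCatMADSRun P R) {s : CenterKind} {k : ℕ} {x : MixedPoint C p n}
    (hx : R.center s k = some x) (hf : x ∈ P.feasible) : s = .fea := by
  cases s with
  | fea => rfl
  | inf =>
    exact absurd hf (MixedProblem.notMem_feasible_of_h_pos (hR.center_mem .inf k x hx).1.2.1)

theorem kind_eq_inf (hR : IsCatMADSRun P R) {s : CenterKind} {k : ℕ} {x : MixedPoint C p n}
    (hx : R.center s k = some x) (hf : x ∉ P.feasible) : s = .inf := by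
  cases s with
  | fea => exact absurd (hR.center_mem .fea k x hx).1.2 hf
  | inf => rfl

theorem quantPoll_subset_evaluated (hR : IsCatMADSRun P R) {s : CenterKind} {k : ℕ}
    {x : MixedPoint C p n} (hx : R.center s k = some x) (hk : ¬ R.IsDominating P k) :
    P.quantPoll (R.δint k) (R.δcont k) x (R.dirs s k) ⊆ R.evaluated k := fun _ hy =>
  hR.evaluated_all k hk (Or.inl (Or.inr ⟨s, x, hx, Or.inr hy⟩))

theorem f_center_le (hR : IsCatMADSRun P R) {s : CenterKind} {k : ℕ} {x y : MixedPoint C p n}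
    (hk : R.IsUnsuccessful P k) (hx : R.center s k = some x) (hxf : x ∈ P.feasible)
    (hy : y ∈ P.quantPoll (R.δint k) (R.δcont k) x (R.dirs s k)) (hyf : y ∈ P.feasible) :
    P.f x ≤ P.f y := by
  obtain rfl := hR.kind_eq_fea hx hxf
  by_contra! hlt
  refine hk.1 ⟨y, hR.quantPoll_subset_evaluated hx hk.1 hy, .fea, hyf, fun x' hx' => ?_⟩
  obtain rfl : x = x' := Option.some.inj (hx.symm.trans hx')
  exact ⟨hyf, hxf, hlt⟩

theorem h_center_le (hR : IsCatMADSRun P R) {s : CenterKind} {k : ℕ} {x y : MixedPoint C p n}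
    (hk : R.IsUnsuccessful P k) (hx : R.center s k = some x) (hxf : 0 < P.h x)
    (hy : y ∈ P.quantPoll (R.δint k) (R.δcont k) x (R.dirs s k)) (hyf : 0 < P.h y) :
    P.h x ≤ P.h y := by
  obtain rfl := hR.kind_eq_inf hx (MixedProblem.notMem_feasible_of_h_pos hxf)
  by_contra! hlt
  exact hk.2 ⟨hk.1, y, hR.quantPoll_subset_evaluated hx hk.1 hy, x, hx, hyf, hlt⟩

end IsCatMADSRun

/-! ### Poll steps along refining subsequences -/

/-- A poll point whose direction has zero integer part only moves the continuous component. -/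
theorem meshPoint_of_int_eq_zero {C : Type*} {p n : ℕ} (δint : Fin p → ℕ) (δcont : Fin n → ℝ)
    (x : MixedPoint C p n) {d : Direction p n} (hd : d.1 = 0) :
    meshPoint δint δcont x.cat x d = ⟨x.cat, x.int, x.cont + scaledDir δcont d.2⟩ := by
  simp [meshPoint, hd]

namespace IsRefiningSubsequence

variable {C J : Type*} [Fintype J] {p n : ℕ} {P : MixedProblem C J p n} {R : CatMADSData C p n}
  {K : Set ℕ} {s : ℕ → CenterKind} {x : ℕ → MixedPoint C p n} {xs : MixedPoint C p n}

theorem tendsto_δcont_zero (hR : IsCatMADSRun P R) (hK : IsRefiningSubsequence P R K s x xs)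
    (j : Fin n) : Tendsto (fun k => R.δcont k j) (atTop ⊓ 𝓟 K) (𝓝 0) := by
  have hsq : Tendsto (fun k => (R.δcont k j) ^ 2) (atTop ⊓ 𝓟 K) (𝓝 0) := by
    refine squeeze_zero (fun k => sq_nonneg _) (fun k => ?_)
      (by simpa using hK.mesh_lim.sub_const (p : ℝ))
    have h1 : (p : ℝ) ≤ ∑ i, (R.δint k i : ℝ) ^ 2 := by
      have : ∑ _i : Fin p, (1 : ℝ) ≤ ∑ i, (R.δint k i : ℝ) ^ 2 := Finset.sum_le_sum fun i _ =>
        one_le_pow₀ (by exact_mod_cast hR.δint_pos k i)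
      simpa using this
    have h2 : (R.δcont k j) ^ 2 ≤ ∑ j, (R.δcont k j) ^ 2 :=
      Finset.single_le_sum (f := fun j => (R.δcont k j) ^ 2) (fun j _ => sq_nonneg _)
        (Finset.mem_univ j)
    linarith
  have := hsq.sqrt
  simp only [Real.sqrt_sq_eq_abs, Real.sqrt_zero] at this
  exact (tendsto_zero_iff_abs_tendsto_zero _).2 this

/-- Frame sizes bounded away from zero would keep the mesh sizes away from zero, because the mesh
size rule is positive and nondecreasing. -/
theorem tendsto_Δcont_zero (hR : IsCatMADSRun P R) (hK : IsRefiningSubsequence P R K s x xs)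
    (j : Fin n) : Tendsto (fun k => R.Δcont k j) (atTop ⊓ 𝓟 K) (𝓝 0) := by
  obtain ⟨ρ, hρ, hδ⟩ := hR.δcont_rule j
  have hpos : ∀ k, 0 < R.Δcont k j := by
    intro k
    obtain ⟨a, ha, b, hb⟩ := hR.Δcont_mem k j
    have : 0 < a := by rcases ha with rfl | rfl | rfl <;> norm_num
    rw [hb]
    positivity
  refine tendsto_order.2 ⟨fun a ha => Eventually.of_forall fun k => ha.trans (hpos k),
    fun a ha => ?_⟩
  filter_upwards [(hK.tendsto_δcont_zero hR j).eventually (gt_mem_nhds (hρ.pos a ha))] with k hk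
  by_contra! hle
  rw [hδ] at hk
  exact hk.not_ge (hρ.mono ha (hpos k) hle)

/-- Every nonzero vector `v` is approximated within `η` by poll directions that are followed with
step sizes tending to zero. -/
theorem exists_refining_poll_steps (hR : IsCatMADSRun P R)
    (hK : IsRefiningSubsequence P R K s x xs)
    (hdense : Metric.sphere (0 : EuclideanSpace ℝ (Fin n)) 1 ⊆
      closure ({v | IsRefiningDirection R K s v} ∩ Metric.sphere 0 1))
    {v : EuclideanSpace ℝ (Fin n)} (hv : v ≠ 0) {η : ℝ} (hη : 0 < η) :
    ∃ (L : Set ℕ) (d : ℕ → Direction p n) (e : ℕ → EuclideanSpace ℝ (Fin n)) (t : ℕ → ℝ),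
      L ⊆ K ∧ L.Infinite ∧ (∀ k ∈ L, d k ∈ R.dirs (s k) k ∧ (d k).1 = 0) ∧
      Tendsto t (atTop ⊓ 𝓟 L) (𝓝[>] 0) ∧ (∀ᶠ k in atTop ⊓ 𝓟 L, e k ∈ Metric.ball v η) ∧
      ∀ᶠ k in atTop ⊓ 𝓟 L, t k • e k = scaledDir (R.δcont k) (d k).2 := by
  have hv0 : 0 < ‖v‖ := norm_pos_iff.2 hv
  obtain ⟨r, ⟨hr, hr1⟩, hdist⟩ := Metric.mem_closure_iff.1
    (hdense (by simp [norm_smul, hv0.ne'] : ‖v‖⁻¹ • v ∈ Metric.sphere 0 1)) (η / ‖v‖)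
    (div_pos hη hv0)
  rw [mem_sphere_zero_iff_norm] at hr1
  obtain ⟨-, L, d, hLK, hL, hd, hlim⟩ := hr
  rw [hr1, inv_one, one_smul] at hlim
  set V : ℕ → EuclideanSpace ℝ (Fin n) := fun k => scaledDir (R.δcont k) (d k).2
  change Tendsto (fun k => ‖V k‖⁻¹ • V k) _ _ at hlim
  have hle : atTop ⊓ 𝓟 L ≤ atTop ⊓ 𝓟 K := inf_le_inf_left _ (principal_mono.2 hLK)
  have hVlim : Tendsto V (atTop ⊓ 𝓟 L) (𝓝 0) := by
    have hcoord : Tendsto (fun k j => R.δcont k j * ((d k).2 j : ℝ)) (atTop ⊓ 𝓟 L) (𝓝 0) := by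
      refine tendsto_pi_nhds.2 fun j => ?_
      refine squeeze_zero_norm' ?_ ((hK.tendsto_Δcont_zero hR j).mono_left hle)
      filter_upwards [mem_inf_of_right (mem_principal_self L)] with k hk
      have hc : (R.center (s k) k).isSome := by rw [hK.pollCenter k (hLK hk)]; rfl
      exact (hR.dirs_frame (s k) k hc _ (hd k hk).1).2 j
    exact ((PiLp.continuous_toLp 2 (fun _ : Fin n => ℝ)).tendsto 0).comp hcoord
  -- The normalized vectors converge to a unit vector, so they cannot be zero (the junk value of
  -- `‖0‖⁻¹ • 0`).
  have hVne : ∀ᶠ k in atTop ⊓ 𝓟 L, V k ≠ 0 := by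
    have hr0 : r ≠ 0 := by rintro rfl; simp at hr1
    filter_upwards [hlim.eventually_ne hr0] with k hk h0
    simp [h0] at hk
  refine ⟨L, d, fun k => ‖v‖ • (‖V k‖⁻¹ • V k), fun k => ‖V k‖ / ‖v‖, hLK, hL, hd, ?_, ?_, ?_⟩
  · refine tendsto_nhdsWithin_iff.2 ⟨by simpa using hVlim.norm.div_const ‖v‖, ?_⟩
    filter_upwards [hVne] with k hk
    exact div_pos (norm_pos_iff.2 hk) hv0
  · refine (hlim.const_smul ‖v‖).eventually (Metric.isOpen_ball.mem_nhds ?_)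
    have : ‖v‖ • r - v = ‖v‖ • (r - ‖v‖⁻¹ • v) := by
      rw [smul_sub, smul_inv_smul₀ hv0.ne']
    rw [Metric.mem_ball, dist_eq_norm, this, norm_smul, norm_norm, mul_comm]
    rw [dist_comm, dist_eq_norm] at hdist
    exact (lt_div_iff₀ hv0).1 hdist
  · filter_upwards [hVne] with k hk
    have : ‖V k‖ ≠ 0 := norm_ne_zero_iff.2 hk
    rw [smul_smul, smul_smul]
    have h1 : ‖V k‖ / ‖v‖ * ‖v‖ * ‖V k‖⁻¹ = 1 := by field_simp
    rw [h1, one_smul]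

/-- Nonnegativity of the generalized derivative, when the poll points around the poll centers that
fall in `S` eventually do not decrease `F`. -/
theorem clarkeDeriv_nonneg (hR : IsCatMADSRun P R) (hK : IsRefiningSubsequence P R K s x xs)
    (hdense : Metric.sphere (0 : EuclideanSpace ℝ (Fin n)) 1 ⊆
      closure ({v | IsRefiningDirection R K s v} ∩ Metric.sphere 0 1))
    {S X : Set (EuclideanSpace ℝ (Fin n))} {F : EuclideanSpace ℝ (Fin n) → EReal} (hSX : S ⊆ X)
    (hF : LipschitzNear X F xs.cont) (hxs : xs.cont ∈ S)
    (hxS : ∀ᶠ k in atTop ⊓ 𝓟 K, (x k).cont ∈ S) {N : Set (EuclideanSpace ℝ (Fin n))}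
    (hN : N ∈ 𝓝[S] xs.cont)
    (hfail : ∀ᶠ k in atTop ⊓ 𝓟 K, ∀ d ∈ R.dirs (s k) k, d.1 = 0 →
      (x k).cont + scaledDir (R.δcont k) d.2 ∈ S → (x k).cont + scaledDir (R.δcont k) d.2 ∈ N →
      F (x k).cont ≤ F ((x k).cont + scaledDir (R.δcont k) d.2))
    {v : EuclideanSpace ℝ (Fin n)} (hv : v ∈ hypertangentCone S xs.cont) :
    0 ≤ clarkeDeriv S F xs.cont v := by
  refine clarkeDeriv_nonneg_of_steps hSX hF hv fun η hη => ?_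
  rcases eq_or_ne v 0 with rfl | hv0
  -- The zero direction need not be approximated by refining directions, but it needs no poll: the
  -- null steps at `xs.cont` itself do not decrease `F`.
  · refine ⟨atTop, fun _ => xs.cont, fun _ => 0, fun k => 1 / ((k : ℝ) + 1), inferInstance,
      tendsto_const_nhds, Eventually.of_forall fun _ => hxs,
      tendsto_nhdsWithin_iff.2 ⟨tendsto_one_div_add_atTop_nhds_zero_nat,
        Eventually.of_forall fun k => ?_⟩,
      Eventually.of_forall fun _ => Metric.mem_ball_self hη, Eventually.of_forall fun _ => ?_⟩
    · exact Nat.one_div_pos_of_nat (α := ℝ)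
    · simp
  obtain ⟨L, d, e, t, hLK, hL, hd, ht, he, hte⟩ := hK.exists_refining_poll_steps hR hdense hv0 hη
  have hle : atTop ⊓ 𝓟 L ≤ atTop ⊓ 𝓟 K := inf_le_inf_left _ (principal_mono.2 hLK)
  have hw : Tendsto (fun k => (x k).cont) (atTop ⊓ 𝓟 L) (𝓝 xs.cont) := hK.cont_lim.mono_left hle
  refine ⟨atTop ⊓ 𝓟 L, fun k => (x k).cont, e, t, ?_, hw, hle hxS, ht, he, ?_⟩
  · exact frequently_mem_iff_neBot.1 (Nat.frequently_atTop_iff_infinite.2 hL)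
  have hstep : Tendsto (fun k => (x k).cont + t k • e k) (atTop ⊓ 𝓟 L) (𝓝 xs.cont) := by
    have ht0 : Tendsto t (atTop ⊓ 𝓟 L) (𝓝 0) := ht.mono_right nhdsWithin_le_nhds
    have h0 : Tendsto (fun k => t k • e k) (atTop ⊓ 𝓟 L) (𝓝 0) := by
      refine ht0.zero_smul_isBoundedUnder_le ⟨‖v‖ + η, ?_⟩
      rw [eventually_map]
      filter_upwards [he] with k hk
      rw [Metric.mem_ball, dist_eq_norm] at hk
      have := norm_le_norm_add_norm_sub' (e k) v
      change ‖e k‖ ≤ _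
      linarith
    simpa using hw.add h0
  filter_upwards [hte, hle hfail, mem_inf_of_right (mem_principal_self L),
    hstep.eventually (mem_nhdsWithin_iff_eventually.1 hN)] with k h1 h2 h3 h4 h5
  have h6 := h4 h5
  rw [h1] at h5 h6 ⊢
  exact h2 _ (hd k h3).1 (hd k h3).2 h5 h6

end IsRefiningSubsequence

/-! ### Convergence -/

theorem mainTheorem1 {C J : Type*} [Finite C] [Fintype J] {p n : ℕ}
    (P : MixedProblem C J p n) (R : CatMADSData C p n) (hR : IsCatMADSRun P R)
    (K : Set ℕ) (s : ℕ → CenterKind) (x : ℕ → MixedPoint C p n) (xs : MixedPoint C p n)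
    (hK : IsRefiningSubsequence P R K s x xs)
    (hdense : Metric.sphere (0 : EuclideanSpace ℝ (Fin n)) 1 ⊆
      closure ({v | IsRefiningDirection R K s v} ∩ Metric.sphere 0 1)) :
    ((∀ k ∈ K, x k ∈ P.feasible) → xs ∈ P.feasible →
      LipschitzNear P.Xcont (P.fStar xs) xs.cont →
      ∀ v ∈ hypertangentCone (P.contFeasible xs) xs.cont,
        0 ≤ clarkeDeriv (P.contFeasible xs) (P.fStar xs) xs.cont v) ∧
    (xs ∈ P.dom \ P.feasible →
      LipschitzNear P.Xcont (P.hStar xs) xs.cont →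
      ∀ v ∈ hypertangentCone P.Xcont xs.cont,
        0 ≤ clarkeDeriv P.Xcont (P.hStar xs) xs.cont v) := by
  have hmemK : ∀ᶠ k in atTop ⊓ 𝓟 K, k ∈ K := mem_inf_of_right (mem_principal_self K)
  -- Eventually the poll centers, and with them the poll points whose direction has zero integer
  -- part, lie in the continuous slice through `xs`.
  have hslice : ∀ᶠ k in atTop ⊓ 𝓟 K, (∀ u, (⟨xs.cat, xs.int, u⟩ : MixedPoint C p n) =
      ⟨(x k).cat, (x k).int, u⟩) := by
    filter_upwards [hK.cat_lim, hK.int_lim] with k h1 h2 u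
    rw [h1, h2]
  have hpoll : ∀ᶠ k in atTop ⊓ 𝓟 K, ∀ d ∈ R.dirs (s k) k, d.1 = 0 →
      (x k).cont + scaledDir (R.δcont k) d.2 ∈ P.Xcont →
      (⟨xs.cat, xs.int, (x k).cont + scaledDir (R.δcont k) d.2⟩ : MixedPoint C p n) ∈
        P.quantPoll (R.δint k) (R.δcont k) (x k) (R.dirs (s k) k) := by
    filter_upwards [hslice] with k h1 d hd hd0 hX
    exact ⟨⟨hK.mem_dom.1, hX⟩, d, hd, by rw [meshPoint_of_int_eq_zero _ _ _ hd0, h1]⟩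
  constructor
  · intro hfea hxs hLip v hv
    refine hK.clarkeDeriv_nonneg hR hdense (S := P.contFeasible xs) (fun u hu => hu.1) hLip
      ⟨hxs.1.2, hxs⟩ ?_
      univ_mem ?_ hv
    · filter_upwards [hslice, hmemK] with k h1 hk
      exact ⟨(hfea k hk).1.2, by rw [h1]; exact hfea k hk⟩
    · filter_upwards [hslice, hmemK, hpoll] with k h1 hk h2 d hd hd0 hS _
      have hle := hR.f_center_le (hK.unsuccessful k hk) (hK.pollCenter k hk) (hfea k hk)
        (h2 d hd hd0 hS.1) hS.2
      have hx : P.fStar xs (x k).cont = P.f (x k) := by rw [MixedProblem.fStar, h1]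
      rw [hx]
      exact hle
  · intro hxs hLip v hv
    have hpos : ∀ᶠ u in 𝓝[P.Xcont] xs.cont, 0 < P.hStar xs u :=
      hLip.eventually_pos hxs.1.2 (MixedProblem.h_pos_of_notMem_feasible hxs.2)
    have hxX : ∀ᶠ k in atTop ⊓ 𝓟 K, (x k).cont ∈ P.Xcont := hmemK.mono fun k hk =>
      (hR.center_mem_dom (hK.pollCenter k hk)).2
    refine hK.clarkeDeriv_nonneg hR hdense subset_rfl hLip hxs.1.2 hxX hpos ?_ hv
    have hxpos : ∀ᶠ k in atTop ⊓ 𝓟 K, 0 < P.hStar xs (x k).cont :=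
      (tendsto_nhdsWithin_iff.2 ⟨hK.cont_lim, hxX⟩ :
        Tendsto (fun k => (x k).cont) _ (𝓝[P.Xcont] xs.cont)).eventually hpos
    filter_upwards [hslice, hmemK, hpoll, hxpos] with k h1 hk h2 h3 d hd hd0 hS h4
    have hx : P.hStar xs (x k).cont = P.h (x k) := by rw [MixedProblem.hStar, h1]
    rw [hx] at h3 ⊢
    exact hR.h_center_le (hK.unsuccessful k hk) (hK.pollCenter k hk) h3 (h2 d hd hd0 hS) h4
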